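/- Let $R$ be a ring with an exhaustive and separated ascending filtration $FR=(F_nR)_{n\in\mathbb Z}$ by additive subgroups, with $1\in F_0R$ and $F_mR\,F_nR\subset F_{m+n}R$. *Kernel functors.* A kernel functor $\kappa$ on left $R$-modules is a left exact subfunctor of the identity with $\kappa(N/\kappa(N))=0$ for all $N$. Let $\mathcal L(\kappa)=\{L \text{ left ideal}: \kappa(R/L)=R/L\}$ be its Gabriel filter, and write $\kappa\le\tau$ if $\kappa(N)\subset\tau(N)$ for all $N$. The meet is $(\wedge\kappa_i)(N)=\bigcap_i\kappa_i(N)$, and $\kappa\vee\tau$ is the smallest kernel functor above $\kappa$ and $\tau$. The localization is $Q_\kappa(N)=\varinjlim_{I\in\mathcal L(\kappa)}\mathrm{Hom}_R(I,N/\kappa(N))$, and for $\kappa\le\tau$ there is a canonical restriction map $\rho: Q_\kappa(N)\to Q_\tau(N)$. The kernel functor $\kappa$ is called pseudo-affine (with respect to $FR$) if the left ideals of the Rees ring $\widetilde R=\bigoplus_n F_nR\,X^n\subset R[X,X^{-1}]$ that contain $\widetilde I=\bigoplus_n (I\cap F_nR)X^n$ for some $I\in\mathcal L(\kappa)$ form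 the Gabriel filter of a kernel functor on $\widetilde R$-modules. *Gliders.* Let $M\subset\Omega$ be a glider representation with $\Omega=RM$: $\Omega$ is a left $R$-module and $M=M_0\supseteq M_1\supseteq\cdots$ is a chain of additive subgroups of $\Omega$ with $F_iR\cdot M_j\subset M_{j-i}$ whenever $i\le j$, and $M$ generates $\Omega$ as an $R$-module. Give $\Omega$ the filtration $F_n\Omega=\sum_{i-j=n}F_iR\,M_j$ (so $F_{-n}\Omega=M_n$ for $n\ge 0$). For a kernel functor $\kappa$, give $\Omega/\kappa(\Omega)$ the image filtration and $Q_\kappa(\Omega)$ the quotient filtration $$F_\gamma Q_\kappa(\Omega)=\{q:\ \exists I\in\mathcal L(\kappa)\ \forall n\in\mathbb Z,\ (F_nR\cap I)\,q\subset F_{n+\gamma}(\Omega/\kappa(\Omega))\},$$ where $\Omega/\kappa(\Omega)$ is viewed inside $Q_\kappa(\Omega)$, and put $Q_\kappa(M)=F_0Q_\kappa(\Omega)$. One says that $\Omega$ is $\kappa$-separated if for all $n\in\mathbb Z$ and $m\in F_n\Omega\setminus F_{n-1}\Omega$, the existence of $I\in\mathcal L(\kappa)$ with $(F_\gamma R\cap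 I)\,m\subset F_{\gamma+n-1}\Omega$ for all $\gamma\in\mathbb Z$ implies $m\in\kappa(\Omega)$. *Statement.* Let $(\kappa_i)_i$ be a finite family of kernel functors on left $R$-modules such that $\Omega$ is $\kappa_i\wedge\kappa_j$-separated for all $i,j$. Assume that $FR$ is positive ($F_nR=0$ for $n<0$), or that every $\kappa_i$ is pseudo-affine. Let $x_i\in F_0Q_{\kappa_i}(\Omega)=Q_{\kappa_i}(M)$ be such that $x_i$ and $x_j$ have the same image in $Q_{\kappa_i\vee\kappa_j}(\Omega)$ for all $i,j$, and suppose that there is an $x\in Q_{\wedge\kappa_i}(\Omega)$ with $\rho_i(x)=x_i$ for all $i$, where $\rho_i:Q_{\wedge\kappa_i}(\Omega)\to Q_{\kappa_i}(\Omega)$ is the restriction map. Then $x\in F_0Q_{\wedge\kappa_i}(\Omega)=Q_{\wedge\kappa_i}(M)$. -/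

import Mathlib

universe u

/-! ### Kernel functors and their Gabriel filters -/

/-- A kernel functor on the category of left `R`-modules: a subfunctor `M ↦ tors M` of the
identity functor that is left exact (`tors N = tors M ∩ N` for every submodule `N` of `M`) and
radical (`tors (M / tors M) = 0`). -/
structure KernelFunctor (R : Type u) [Ring R] where
  tors : ∀ (M : Type u) [AddCommGroup M] [Module R M], Submodule R M
  map_tors_le : ∀ {M N : Type u} [AddCommGroup M] [Module R M] [AddCommGroup N] [Module R N]
    (f : M →ₗ[R] N), (tors M).map f ≤ tors N
  tors_submodule : ∀ {M : Type u} [AddCommGroup M] [Module R M] (N : Submodule R M),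
    tors N = (tors M).comap N.subtype
  tors_quotient : ∀ (M : Type u) [AddCommGroup M] [Module R M], tors (M ⧸ tors M) = ⊥

namespace KernelFunctor

section Filter

variable {R : Type u} [Ring R] (κ : KernelFunctor R)

theorem apply_mem_tors {M N : Type u} [AddCommGroup M] [Module R M] [AddCommGroup N] [Module R N]
    (f : M →ₗ[R] N) {m : M} (hm : m ∈ κ.tors M) : f m ∈ κ.tors N :=
  κ.map_tors_le f (Submodule.mem_map_of_mem hm)

theorem mem_tors_of_injective {M N : Type u} [AddCommGroup M] [Module R M] [AddCommGroup N]
    [Module R N] (f : M →ₗ[R] N) (hf : Function.Injective f) {m : M} (hm : f m ∈ κ.tors N) :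
    m ∈ κ.tors M := by
  have h1 : (⟨f m, LinearMap.mem_range_self f m⟩ : LinearMap.range f) ∈
      κ.tors (LinearMap.range f) := by
    rw [κ.tors_submodule]
    exact hm
  have h2 := κ.apply_mem_tors (LinearEquiv.ofInjective f hf).symm.toLinearMap h1
  have h3 : (LinearEquiv.ofInjective f hf).symm ⟨f m, LinearMap.mem_range_self f m⟩ = m := by
    rw [LinearEquiv.symm_apply_eq]
    rfl
  simpa [h3] using h2

/-- `L` belongs to the filter of `κ` when `κ(R/L) = R/L`. -/
def IsDense (L : Ideal R) : Prop := κ.tors (R ⧸ L) = ⊤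

theorem isDense_iff_mk_one (L : Ideal R) :
    κ.IsDense L ↔ (Submodule.Quotient.mk 1 : R ⧸ L) ∈ κ.tors (R ⧸ L) := by
  refine ⟨fun h => by rw [show κ.tors (R ⧸ L) = ⊤ from h]; trivial, fun h => ?_⟩
  refine eq_top_iff.2 fun x _ => ?_
  obtain ⟨r, rfl⟩ := Submodule.Quotient.mk_surjective L x
  have := (κ.tors (R ⧸ L)).smul_mem r h
  rwa [← Submodule.Quotient.mk_smul, smul_eq_mul, mul_one] at this

/-- An element is torsion if and only if its annihilator belongs to the filter. -/
theorem mem_tors_iff {M : Type u} [AddCommGroup M] [Module R M] (m : M) :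
    m ∈ κ.tors M ↔ κ.IsDense (LinearMap.ker (LinearMap.toSpanSingleton R M m)) := by
  set f := LinearMap.toSpanSingleton R M m
  have hinj : Function.Injective ((LinearMap.ker f).liftQ f le_rfl) := by
    rw [← LinearMap.ker_eq_bot, Submodule.ker_liftQ_eq_bot' _ _ rfl]
  have h1 : (LinearMap.ker f).liftQ f le_rfl (Submodule.Quotient.mk 1) = m := by
    rw [Submodule.liftQ_apply]
    simp [f]
  rw [isDense_iff_mk_one]
  constructor
  · intro h
    exact κ.mem_tors_of_injective _ hinj (by rwa [h1])
  · intro h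
    have := κ.apply_mem_tors ((LinearMap.ker f).liftQ f le_rfl) h
    rwa [h1] at this

theorem isDense_top : κ.IsDense ⊤ := by
  rw [isDense_iff_mk_one]
  have : (Submodule.Quotient.mk 1 : R ⧸ (⊤ : Ideal R)) = 0 :=
    (Submodule.Quotient.mk_eq_zero _).2 trivial
  rw [this]
  exact Submodule.zero_mem _

theorem IsDense.mono {κ : KernelFunctor R} {I J : Ideal R} (hI : κ.IsDense I) (h : I ≤ J) :
    κ.IsDense J := by
  rw [isDense_iff_mk_one] at hI ⊢
  exact κ.apply_mem_tors (Submodule.mapQ I J LinearMap.id h) hI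

theorem IsDense.inf {κ : KernelFunctor R} {I J : Ideal R} (hI : κ.IsDense I) (hJ : κ.IsDense J) :
    κ.IsDense (I ⊓ J) := by
  rw [isDense_iff_mk_one] at hI hJ
  have h := add_mem (κ.apply_mem_tors (LinearMap.inl R (R ⧸ I) (R ⧸ J)) hI)
    (κ.apply_mem_tors (LinearMap.inr R (R ⧸ I) (R ⧸ J)) hJ)
  refine ((κ.mem_tors_iff _).1 h).mono fun a ha => ?_
  have ha' := LinearMap.mem_ker.1 ha
  simp only [LinearMap.inl_apply, LinearMap.inr_apply, Prod.mk_add_mk, add_zero, zero_add,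
    LinearMap.toSpanSingleton_apply, Prod.smul_mk, Prod.mk_eq_zero, ← Submodule.Quotient.mk_smul,
    smul_eq_mul, mul_one, Submodule.Quotient.mk_eq_zero] at ha'
  exact ha'

/-- The left ideal `(I : r) = {a | a r ∈ I}`. -/
def colonRight (I : Ideal R) (r : R) : Ideal R :=
  Submodule.comap (LinearMap.toSpanSingleton R R r) I

theorem mem_colonRight {I : Ideal R} {r a : R} : a ∈ colonRight I r ↔ a * r ∈ I := Iff.rfl

theorem IsDense.colonRight {κ : KernelFunctor R} {I : Ideal R} (hI : κ.IsDense I) (r : R) :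
    κ.IsDense (colonRight I r) := by
  have h : (Submodule.Quotient.mk r : R ⧸ I) ∈ κ.tors (R ⧸ I) := by
    rw [show κ.tors (R ⧸ I) = ⊤ from hI]; trivial
  refine ((κ.mem_tors_iff _).1 h).mono fun a ha => ?_
  have ha' := LinearMap.mem_ker.1 ha
  rw [LinearMap.toSpanSingleton_apply, ← Submodule.Quotient.mk_smul,
    Submodule.Quotient.mk_eq_zero] at ha'
  exact ha'

/-- The Gabriel filter `{L | κ(R/L) = R/L}` of the kernel functor `κ`. -/
def filter : IdealFilter R :=
  Order.IsPFilter.toPFilter (F := {L : Ideal R | κ.IsDense L}) <|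
    Order.IsPFilter.of_def ⟨⊤, κ.isDense_top⟩
      (fun I hI J hJ => ⟨I ⊓ J, hI.inf hJ, inf_le_left, inf_le_right⟩)
      (fun h hI => IsDense.mono hI h)

theorem mem_filter {L : Ideal R} : L ∈ κ.filter ↔ κ.tors (R ⧸ L) = ⊤ := Iff.rfl

end Filter

/-! ### The lattice of kernel functors -/

section Lattice

variable {R : Type u} [Ring R]

/-- `κ ≤ τ` means `κ(M) ⊆ τ(M)` for every module `M`. -/
instance : LE (KernelFunctor R) where
  le κ τ := ∀ (M : Type u) [AddCommGroup M] [Module R M], κ.tors M ≤ τ.tors M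

/-- The meet of a family of kernel functors: `(⋀ κ)(M) = ⋂ κ(M)`. -/
instance : InfSet (KernelFunctor R) where
  sInf S :=
    { tors := fun M _ _ => ⨅ κ ∈ S, κ.tors M
      map_tors_le := by
        intro M N _ _ _ _ f
        rw [Submodule.map_le_iff_le_comap]
        intro m hm
        simp only [Submodule.mem_comap, Submodule.mem_iInf] at hm ⊢
        exact fun κ hκ => κ.apply_mem_tors f (hm κ hκ)
      tors_submodule := by
        intro M _ _ N
        ext m
        simp only [Submodule.mem_comap, Submodule.mem_iInf]
        refine forall_congr' fun κ => forall_congr' fun _ => ?_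
        rw [κ.tors_submodule]
        rfl
      tors_quotient := by
        intro M _ _
        rw [eq_bot_iff]
        intro x hx
        obtain ⟨m, rfl⟩ := Submodule.Quotient.mk_surjective _ x
        rw [Submodule.mem_bot, Submodule.Quotient.mk_eq_zero]
        simp only [Submodule.mem_iInf] at hx ⊢
        intro κ hκ
        have h := κ.apply_mem_tors (Submodule.mapQ (⨅ σ ∈ S, σ.tors M) (κ.tors M) LinearMap.id
          (iInf₂_le κ hκ)) (hx κ hκ)
        rw [κ.tors_quotient, Submodule.mem_bot, Submodule.mapQ_apply,
          Submodule.Quotient.mk_eq_zero] at h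
        exact h }

theorem mem_tors_sInf (S : Set (KernelFunctor R)) {M : Type u} [AddCommGroup M] [Module R M]
    {m : M} : m ∈ (sInf S).tors M ↔ ∀ κ ∈ S, m ∈ κ.tors M := by
  change m ∈ (⨅ κ ∈ S, κ.tors M : Submodule R M) ↔ _
  simp only [Submodule.mem_iInf]

/-- The meet `κ ∧ τ`. -/
instance : Min (KernelFunctor R) where
  min κ τ := sInf {κ, τ}

/-- The join `κ ∨ τ`: the smallest kernel functor above `κ` and `τ`. -/
instance : Max (KernelFunctor R) where
  max κ τ := sInf {σ | κ ≤ σ ∧ τ ≤ σ}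

theorem le_join_left (κ τ : KernelFunctor R) : κ ≤ κ ⊔ τ := fun M _ _ _ hm =>
  (mem_tors_sInf _).2 fun _ hσ => hσ.1 M hm

theorem le_join_right (κ τ : KernelFunctor R) : τ ≤ κ ⊔ τ := fun M _ _ _ hm =>
  (mem_tors_sInf _).2 fun _ hσ => hσ.2 M hm

theorem meet_le {ι : Type*} (κ : ι → KernelFunctor R) (i : ι) : (⨅ i, κ i) ≤ κ i :=
  fun _ _ _ _ hm => (mem_tors_sInf _).1 hm _ ⟨i, rfl⟩

theorem filter_mono {κ τ : KernelFunctor R} (h : κ ≤ τ) {L : Ideal R} (hL : L ∈ κ.filter) :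
    L ∈ τ.filter :=
  eq_top_iff.2 (le_trans (eq_top_iff.1 (κ.mem_filter.1 hL)) (h _))

end Lattice

/-! ### Localization at a kernel functor -/

section HomLim

variable {R : Type u} [Ring R] (κ : KernelFunctor R)
variable (N : Type u) [AddCommGroup N] [Module R N]

/-- The homomorphisms `I → N` with `I` in the Gabriel filter of `κ`. -/
def PartialHom : AddSubmonoid (R →ₗ.[R] N) where
  carrier := {f | f.domain ∈ κ.filter}
  add_mem' {f g} (hf : f.domain ∈ κ.filter) (hg : g.domain ∈ κ.filter) :=
    show f.domain ⊓ g.domain ∈ κ.filter from Order.PFilter.inf_mem hf hg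
  zero_mem' := κ.isDense_top

/-- Two partial homomorphisms are identified when they agree on some ideal of the filter. -/
def homCon : AddCon (PartialHom κ N) where
  r f g := ∃ K ∈ κ.filter, ∃ (hf : K ≤ f.1.domain) (hg : K ≤ g.1.domain),
    ∀ a (ha : a ∈ K), f.1 ⟨a, hf ha⟩ = g.1 ⟨a, hg ha⟩
  iseqv :=
    { refl := fun f => ⟨f.1.domain, f.2, le_rfl, le_rfl, fun _ _ => rfl⟩
      symm := fun ⟨K, hK, hf, hg, h⟩ => ⟨K, hK, hg, hf, fun a ha => (h a ha).symm⟩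
      trans := fun ⟨K, hK, hf, _, h⟩ ⟨K', hK', _, hg', h'⟩ =>
        ⟨K ⊓ K', Order.PFilter.inf_mem hK hK', inf_le_left.trans hf, inf_le_right.trans hg',
          fun a ha => (h a ha.1).trans (h' a ha.2)⟩ }
  add' := fun ⟨K, hK, hf, hg, h⟩ ⟨K', hK', hf', hg', h'⟩ =>
    ⟨K ⊓ K', Order.PFilter.inf_mem hK hK',
      le_inf (inf_le_left.trans hf) (inf_le_right.trans hf'),
      le_inf (inf_le_left.trans hg) (inf_le_right.trans hg'),
      fun a ha => congrArg₂ (· + ·) (h a ha.1) (h' a ha.2)⟩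

/-- The direct limit of the groups `Hom_R(I, N)` over the ideals `I` in the filter of `κ`. -/
def HomLim : Type u := (homCon κ N).Quotient

instance : AddCommMonoid (HomLim κ N) := inferInstanceAs (AddCommMonoid (homCon κ N).Quotient)

variable {κ N}

/-- The class of a partial homomorphism. -/
def HomLim.mk (f : PartialHom κ N) : HomLim κ N := (f : (homCon κ N).Quotient)

theorem HomLim.mk_surjective : Function.Surjective (HomLim.mk : PartialHom κ N → HomLim κ N) :=
  Quotient.mk''_surjective

theorem HomLim.mk_eq_mk {f g : PartialHom κ N} : HomLim.mk f = HomLim.mk g ↔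
    ∃ K ∈ κ.filter, ∃ (hf : K ≤ f.1.domain) (hg : K ≤ g.1.domain),
      ∀ a (ha : a ∈ K), f.1 ⟨a, hf ha⟩ = g.1 ⟨a, hg ha⟩ :=
  (homCon κ N).eq

theorem HomLim.mk_add (f g : PartialHom κ N) :
    HomLim.mk (f + g) = HomLim.mk f + HomLim.mk g := rfl

theorem HomLim.mk_zero : HomLim.mk (0 : PartialHom κ N) = 0 := rfl

/-- The action of `r` sends `f : I → N` to the homomorphism `b ↦ f (b r)` on `(I : r)`. -/
def partialAct (r : R) (f : PartialHom κ N) : PartialHom κ N :=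
  ⟨{ domain := colonRight f.1.domain r
     toFun := f.1.toFun ∘ₗ ((LinearMap.toSpanSingleton R R r).restrict fun _ hb => hb) },
    IsDense.colonRight f.2 r⟩

instance : SMul R (HomLim κ N) where
  smul r := Quotient.map' (partialAct r) (by
    rintro f g ⟨K, hK, hf, hg, h⟩
    exact ⟨colonRight K r, IsDense.colonRight hK r, fun b hb => hf hb, fun b hb => hg hb,
      fun b hb => h (b * r) hb⟩)

theorem HomLim.smul_mk (r : R) (f : PartialHom κ N) :
    r • HomLim.mk f = HomLim.mk (partialAct r f) := rfl

theorem partialHom_congr (f : PartialHom κ N) {a b : R} (h : a = b) (ha : a ∈ f.1.domain)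
    (hb : b ∈ f.1.domain) : f.1 ⟨a, ha⟩ = f.1 ⟨b, hb⟩ := by
  subst h; rfl

instance : Module R (HomLim κ N) where
  one_smul x := by
    obtain ⟨f, rfl⟩ := HomLim.mk_surjective x
    rw [HomLim.smul_mk, HomLim.mk_eq_mk]
    exact ⟨f.1.domain, f.2, fun b hb => show b * 1 ∈ f.1.domain by rwa [mul_one], le_rfl,
      fun b hb => partialHom_congr f (mul_one b) _ _⟩
  mul_smul r s x := by
    obtain ⟨f, rfl⟩ := HomLim.mk_surjective x
    rw [HomLim.smul_mk, HomLim.smul_mk, HomLim.smul_mk, HomLim.mk_eq_mk]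
    exact ⟨(partialAct (r * s) f).1.domain, (partialAct (r * s) f).2, le_rfl,
      fun b hb => show b * r * s ∈ f.1.domain by rw [mul_assoc]; exact hb,
      fun b hb => partialHom_congr f (mul_assoc b r s).symm _ _⟩
  smul_zero r := by
    rw [← HomLim.mk_zero, HomLim.smul_mk, HomLim.mk_eq_mk]
    exact ⟨⊤, κ.isDense_top, fun _ _ => trivial, le_rfl, fun _ _ => rfl⟩
  smul_add r x y := by
    obtain ⟨f, rfl⟩ := HomLim.mk_surjective x
    obtain ⟨g, rfl⟩ := HomLim.mk_surjective y
    rw [HomLim.smul_mk, HomLim.smul_mk, ← HomLim.mk_add, ← HomLim.mk_add, HomLim.smul_mk,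
      HomLim.mk_eq_mk]
    exact ⟨(partialAct r (f + g)).1.domain, (partialAct r (f + g)).2, le_rfl, fun b hb => hb,
      fun _ _ => rfl⟩
  add_smul r s x := by
    obtain ⟨f, rfl⟩ := HomLim.mk_surjective x
    rw [HomLim.smul_mk, HomLim.smul_mk, HomLim.smul_mk, ← HomLim.mk_add, HomLim.mk_eq_mk]
    have key : ∀ b, b ∈ (partialAct r f + partialAct s f).1.domain → b * (r + s) ∈ f.1.domain := fun b hb => by
      rw [mul_add]; exact add_mem hb.1 hb.2
    refine ⟨(partialAct r f + partialAct s f).1.domain, (partialAct r f + partialAct s f).2, key, le_rfl, fun b hb => ?_⟩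
    refine (partialHom_congr f (mul_add b r s) (key b hb) (add_mem hb.1 hb.2)).trans ?_
    exact f.1.map_add ⟨b * r, hb.1⟩ ⟨b * s, hb.2⟩
  zero_smul x := by
    obtain ⟨f, rfl⟩ := HomLim.mk_surjective x
    rw [HomLim.smul_mk, ← HomLim.mk_zero, HomLim.mk_eq_mk]
    refine ⟨⊤, κ.isDense_top, fun b _ =>
      show b * 0 ∈ f.1.domain by rw [mul_zero]; exact zero_mem _,
      le_rfl, fun b _ => ?_⟩
    exact (partialHom_congr f (mul_zero b) _ (zero_mem _)).trans f.1.map_zero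

instance : AddCommGroup (HomLim κ N) := Module.addCommMonoidToAddCommGroup R

/-- The canonical map `N → lim Hom(I, N)`, sending `n` to the homomorphism `b ↦ b n` on `R`. -/
def HomLim.of (κ : KernelFunctor R) (N : Type u) [AddCommGroup N] [Module R N] :
    N →ₗ[R] HomLim κ N where
  toFun n := HomLim.mk ⟨(LinearMap.toSpanSingleton R N n).toPMap ⊤, κ.isDense_top⟩
  map_add' n n' := by
    rw [← HomLim.mk_add, HomLim.mk_eq_mk]
    exact ⟨⊤, κ.isDense_top, le_rfl, fun _ _ => ⟨trivial, trivial⟩, fun b _ => smul_add b n n'⟩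
  map_smul' r n := by
    rw [RingHom.id_apply, HomLim.smul_mk, HomLim.mk_eq_mk]
    exact ⟨⊤, κ.isDense_top, le_rfl, fun _ _ => trivial, fun b _ => smul_smul b r n⟩

/-- For `κ ≤ τ` and `g : N → N'`, the map sending the class of `f : I → N` to that of `g ∘ f`. -/
def HomLim.map {τ : KernelFunctor R} (h : κ ≤ τ) {N' : Type u} [AddCommGroup N'] [Module R N']
    (g : N →ₗ[R] N') : HomLim κ N →ₗ[R] HomLim τ N' where
  toFun := Quotient.map' (fun f => ⟨g.compPMap f.1, filter_mono h f.2⟩) (by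
    rintro f f' ⟨K, hK, hf, hf', hff'⟩
    exact ⟨K, filter_mono h hK, hf, hf', fun a ha => congrArg g (hff' a ha)⟩)
  map_add' x y := by
    obtain ⟨f, rfl⟩ := HomLim.mk_surjective x
    obtain ⟨f', rfl⟩ := HomLim.mk_surjective y
    refine HomLim.mk_eq_mk.2 ⟨(f + f').1.domain, filter_mono h (f + f').2, le_rfl, le_rfl,
      fun a ha => g.map_add _ _⟩
  map_smul' r x := by
    obtain ⟨f, rfl⟩ := HomLim.mk_surjective x
    rfl

end HomLim

section Loc

variable {R : Type u} [Ring R]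

/-- The localization `Q_κ(M)`: the direct limit of the groups `Hom_R(I, M / κ(M))` over the left
ideals `I` in the Gabriel filter of `κ`. -/
abbrev Loc (κ : KernelFunctor R) (M : Type u) [AddCommGroup M] [Module R M] : Type u :=
  HomLim κ (M ⧸ κ.tors M)

/-- The localization morphism `j_κ : M → Q_κ(M)`. -/
def toLoc (κ : KernelFunctor R) (M : Type u) [AddCommGroup M] [Module R M] : M →ₗ[R] κ.Loc M :=
  HomLim.of κ (M ⧸ κ.tors M) ∘ₗ (κ.tors M).mkQ

/-- For `κ ≤ τ`, the canonical map `ρ : Q_κ(M) → Q_τ(M)`, induced by the projection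
`M / κ(M) → M / τ(M)`. -/
def restrict {κ τ : KernelFunctor R} (h : κ ≤ τ) (M : Type u) [AddCommGroup M] [Module R M] :
    κ.Loc M →ₗ[R] τ.Loc M :=
  HomLim.map h (Submodule.mapQ (κ.tors M) (τ.tors M) LinearMap.id (h M))

end Loc

end KernelFunctor

/-! ### Filtered rings and modules -/

/-- An exhaustive separated `ℤ`-indexed ascending ring filtration with `1 ∈ F₀R`. -/
structure RingFiltration (R : Type u) [Ring R] where
  deg : ℤ → AddSubgroup R
  mono : Monotone deg
  one_mem : (1 : R) ∈ deg 0
  mul_mem : ∀ {m n : ℤ} {a b : R}, a ∈ deg m → b ∈ deg n → a * b ∈ deg (m + n)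
  exhaustive : ∀ a : R, ∃ n, a ∈ deg n
  separated : ∀ a : R, (∀ n, a ∈ deg n) → a = 0

namespace RingFiltration

variable {R : Type u} [Ring R] (F : RingFiltration R)

/-- The filtration is positive: `F_n R = 0` for `n < 0`. -/
def IsPositive : Prop := ∀ n < 0, F.deg n = ⊥

/-- The Rees ring `⨁ F_n R · Xⁿ`, as a subring of `R[X, X⁻¹]`. -/
def rees : Subring (LaurentPolynomial R) where
  carrier := {p | ∀ n, p.coeff n ∈ F.deg n}
  zero_mem' := fun n => (F.deg n).zero_mem
  add_mem' := fun hp hq n => (F.deg n).add_mem (hp n) (hq n)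
  neg_mem' := fun hp n => (F.deg n).neg_mem (hp n)
  one_mem' := fun n => by
    rw [AddMonoidAlgebra.one_def, AddMonoidAlgebra.coeff_single, Finsupp.single_apply]
    split_ifs with h
    · exact h ▸ F.one_mem
    · exact (F.deg n).zero_mem
  mul_mem' := fun {p q} hp hq n => by
    rw [AddMonoidAlgebra.coeff_mul, Finsupp.sum]
    refine (F.deg n).sum_mem fun i _ => (F.deg n).sum_mem fun j _ => ?_
    dsimp only
    split_ifs with h
    · exact h ▸ F.mul_mem (hp i) (hq j)
    · exact (F.deg n).zero_mem

/-- The graded left ideal `Ĩ = ⨁ (I ∩ F_n R) · Xⁿ` of the Rees ring attached to a left ideal `I`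
of `R`. -/
def reesIdeal (I : Ideal R) : Ideal F.rees where
  carrier := {p | ∀ n, p.1.coeff n ∈ I}
  zero_mem' := fun _ => I.zero_mem
  add_mem' := fun hp hq n => I.add_mem (hp n) (hq n)
  smul_mem' := fun p q hq n => by
    rw [smul_eq_mul, Subring.coe_mul, AddMonoidAlgebra.coeff_mul, Finsupp.sum]
    refine I.sum_mem fun i _ => I.sum_mem fun j _ => ?_
    dsimp only
    split_ifs with h
    · exact I.mul_mem_left _ (hq j)
    · exact I.zero_mem

end RingFiltration

/-- `κ` comes from a pseudo-affine kernel functor `κ'` on the Rees ring: the Gabriel filter of `κ'`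
has the ideals `Ĩ`, with `I` in the Gabriel filter of `κ`, as a basis. -/
def KernelFunctor.IsPseudoAffine {R : Type u} [Ring R] (κ : KernelFunctor R)
    (F : RingFiltration R) : Prop :=
  ∃ κ' : KernelFunctor F.rees, ∀ J : Ideal F.rees,
    J ∈ κ'.filter ↔ ∃ I ∈ κ.filter, F.reesIdeal I ≤ J

section Module

variable {R : Type u} [Ring R] (F : RingFiltration R) {Ω : Type u} [AddCommGroup Ω] [Module R Ω]

/-- `Ω`, filtered by `FΩ`, is `κ`-separated: if `m ∈ F_n Ω`, `m ∉ F_{n-1} Ω`, and for some `I` in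
the Gabriel filter `(F_γ R ∩ I) m ⊆ F_{γ+n-1} Ω` for all `γ`, then `m ∈ κ(Ω)`. -/
def KernelFunctor.IsSeparated (κ : KernelFunctor R) (FΩ : ℤ → AddSubgroup Ω) : Prop :=
  ∀ (n : ℤ) (m : Ω), m ∈ FΩ n → m ∉ FΩ (n - 1) →
    (∃ I ∈ κ.filter, ∀ γ, ∀ a ∈ I, a ∈ F.deg γ → a • m ∈ FΩ (γ + n - 1)) → m ∈ κ.tors Ω

/-- The quotient filtration on `Q_κ(Ω)`: an element `q` lies in `F_γ Q_κ(Ω)` when for some `I` in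
the Gabriel filter `(F_n R ∩ I) q ⊆ F_{n+γ}(Ω / κ(Ω))` for all `n`, where `F_n(Ω / κ(Ω))` is the
image of `F_n Ω`, viewed inside `Q_κ(Ω)`. -/
def KernelFunctor.quotientFiltration (κ : KernelFunctor R) (FΩ : ℤ → AddSubgroup Ω) (γ : ℤ) :
    AddSubgroup (κ.Loc Ω) where
  carrier := {q | ∃ I ∈ κ.filter, ∀ n, ∀ a ∈ I, a ∈ F.deg n →
    ∃ m ∈ FΩ (n + γ), a • q = κ.toLoc Ω m}
  zero_mem' := ⟨⊤, κ.isDense_top, fun n _ _ _ => ⟨0, (FΩ _).zero_mem, by simp⟩⟩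
  add_mem' := by
    rintro p q ⟨I, hI, hp⟩ ⟨J, hJ, hq⟩
    refine ⟨I ⊓ J, Order.PFilter.inf_mem hI hJ, fun n a ha han => ?_⟩
    obtain ⟨m, hm, h⟩ := hp n a ha.1 han
    obtain ⟨m', hm', h'⟩ := hq n a ha.2 han
    exact ⟨m + m', add_mem hm hm', by rw [smul_add, h, h', map_add]⟩
  neg_mem' := by
    rintro q ⟨I, hI, hq⟩
    refine ⟨I, hI, fun n a ha han => ?_⟩
    obtain ⟨m, hm, h⟩ := hq n a ha han
    exact ⟨-m, neg_mem hm, by rw [smul_neg, h, map_neg]⟩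

variable (Ω) in
/-- A glider representation `M ⊆ Ω = R M`: a descending chain `M = M₀ ⊇ M₁ ⊇ ⋯` of subgroups of
the `R`-module `Ω` with `F_i R · M_j ⊆ M_{j-i}` for `i ≤ j`. -/
structure Glider where
  part : ℕ → AddSubgroup Ω
  anti : Antitone part
  smul_mem : ∀ (i : ℤ) (j k : ℕ), (k : ℤ) = j - i →
    ∀ r ∈ F.deg i, ∀ m ∈ part j, r • m ∈ part k
  span_eq_top : Submodule.span R (part 0 : Set Ω) = ⊤

namespace Glider

variable {F} (M : Glider F Ω)

/-- The filtration `F_n Ω = ∑_{i - j = n} F_i R · M_j` of `Ω`. -/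
def filtration (n : ℤ) : AddSubgroup Ω :=
  ⨆ j : ℕ, AddSubgroup.closure {x | ∃ r ∈ F.deg (n + j), ∃ m ∈ M.part j, x = r • m}

theorem filtration_neg (k : ℕ) : M.filtration (-k) = M.part k := by
  apply le_antisymm
  · refine iSup_le fun j => (AddSubgroup.closure_le _).2 ?_
    rintro _ ⟨r, hr, m, hm, rfl⟩
    exact M.smul_mem _ j k (by ring) r hr m hm
  · intro m hm
    refine (le_iSup (fun j : ℕ => AddSubgroup.closure
      {x | ∃ r ∈ F.deg (-(k : ℤ) + j), ∃ m ∈ M.part j, x = r • m}) k) ?_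
    exact AddSubgroup.subset_closure ⟨1, by simpa using F.one_mem, m, hm, (one_smul R m).symm⟩

/-- The localized glider `Q_κ(M) = F₀ Q_κ(Ω)`. -/
def localization (κ : KernelFunctor R) : AddSubgroup (κ.Loc Ω) :=
  κ.quotientFiltration F M.filtration 0

end Glider

end Module

/-! Choose `J` in the filter of `⋀ κ i` with `J x` inside the image of `Ω`. For `a ∈ J ∩ F_n R`
write `a x = j(m)`. If `m ∈ F_n Ω`, this `m` is the required witness. Otherwise restriction gives `a
x_i = j_{κ i}(m)` for every `i`, and it suffices that each such relation forces `m ∈ F_n Ω` or `m ∈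
κ_i(Ω)`: then `m` lies in every `κ_i(Ω)`, so `a x = 0`, and `0` is the witness.

This dichotomy for a single `κ` is `Glider.mem_filtration_or_mem_tors_of_smul_eq`. Since `x_i` has
degree `0`, some ideal of the filter carries `m` into the right steps of `FΩ`, but only modulo
`κ(Ω)`. Once the torsion error is removed, separatedness applies: were `m` of degree `N > n`, it
would behave as an element of degree at most `N - 1`, so it would be torsion.

The error is removed in two ways. For positive `FR`, separatedness forces `κ(Ω) = Ω` or `κ(Ω) ⊆ F_0
Ω`, and in the second case the error already lies in the filtration step wanted. For pseudo-affine
`κ`, the Gabriel filter on the Rees ring yields a smaller ideal of the filter on which there is no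
error. -/

namespace KernelFunctor

variable {R : Type u} [Ring R]

/-! ### Gabriel filters and torsion -/

/-- A Gabriel filter contains every left ideal `L` such that `(L : a)` is in the filter for all `a`
in some ideal of the filter. -/
theorem isDense_of_forall_colonRight (κ : KernelFunctor R) {I L : Ideal R} (hI : κ.IsDense I)
    (h : ∀ a ∈ I, κ.IsDense (colonRight L a)) : κ.IsDense L := by
  have key : ∀ a ∈ I, (Submodule.Quotient.mk a : R ⧸ L) ∈ κ.tors (R ⧸ L) := fun a ha => by
    refine (κ.mem_tors_iff _).2 ((h a ha).mono fun b hb => LinearMap.mem_ker.2 ?_)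
    rw [LinearMap.toSpanSingleton_apply, ← Submodule.Quotient.mk_smul,
      Submodule.Quotient.mk_eq_zero]
    exact hb
  -- `R/L` modulo its torsion is torsion-free, so it is enough that the class of `1` there is killed
  -- by `I`.
  rw [isDense_iff_mk_one, ← Submodule.Quotient.mk_eq_zero (κ.tors (R ⧸ L)), ← Submodule.mem_bot R,
    ← κ.tors_quotient]
  refine (κ.mem_tors_iff _).2 (hI.mono fun b hb => LinearMap.mem_ker.2 ?_)
  rw [LinearMap.toSpanSingleton_apply, ← Submodule.Quotient.mk_smul, ← Submodule.Quotient.mk_smul,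
    Submodule.Quotient.mk_eq_zero, smul_eq_mul, mul_one]
  exact key b hb

theorem mem_tors_of_forall_smul_eq_zero (κ : KernelFunctor R) {M : Type u} [AddCommGroup M]
    [Module R M] {m : M} {I : Ideal R} (hI : I ∈ κ.filter) (h : ∀ a ∈ I, a • m = 0) :
    m ∈ κ.tors M :=
  (κ.mem_tors_iff m).2 (IsDense.mono hI fun a ha => LinearMap.mem_ker.2 (h a ha))

theorem exists_forall_smul_eq_zero (κ : KernelFunctor R) {M : Type u} [AddCommGroup M]
    [Module R M] {m : M} (hm : m ∈ κ.tors M) : ∃ I ∈ κ.filter, ∀ a ∈ I, a • m = 0 :=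
  ⟨_, (κ.mem_tors_iff m).1 hm, fun _ ha => LinearMap.mem_ker.1 ha⟩

/-- Lets the pairwise separatedness hypothesis be used on the diagonal `i = j`, as separatedness for
a single kernel functor. -/
theorem mem_tors_min_self (κ : KernelFunctor R) {M : Type u} [AddCommGroup M] [Module R M]
    {m : M} : m ∈ (κ ⊓ κ).tors M ↔ m ∈ κ.tors M :=
  (mem_tors_sInf _).trans (by simp)

theorem mem_filter_min_self (κ : KernelFunctor R) {I : Ideal R} (hI : I ∈ κ.filter) :
    I ∈ (κ ⊓ κ).filter :=
  eq_top_iff.2 fun _ _ => κ.mem_tors_min_self.2 ((eq_top_iff.1 (κ.mem_filter.1 hI)) trivial)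

/-! ### Elements of the localization -/

section Loc

variable {Ω : Type u} [AddCommGroup Ω] [Module R Ω]

theorem HomLim.smul_mk_eq_of (κ : KernelFunctor R) {N : Type u} [AddCommGroup N] [Module R N]
    (f : PartialHom κ N) {a : R} (ha : a ∈ f.1.domain) :
    a • HomLim.mk f = HomLim.of κ N (f.1 ⟨a, ha⟩) := by
  rw [HomLim.smul_mk]
  refine HomLim.mk_eq_mk.2 ⟨⊤, κ.isDense_top, fun b _ => f.1.domain.smul_mem b ha, le_rfl,
    fun b _ => ?_⟩
  exact f.1.map_smul b ⟨a, ha⟩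

theorem exists_smul_eq_toLoc (κ : KernelFunctor R) (x : κ.Loc Ω) :
    ∃ J ∈ κ.filter, ∀ a ∈ J, ∃ m : Ω, a • x = κ.toLoc Ω m := by
  obtain ⟨f, rfl⟩ := HomLim.mk_surjective x
  refine ⟨f.1.domain, f.2, fun a ha => ?_⟩
  obtain ⟨m, hm⟩ := Submodule.Quotient.mk_surjective _ (f.1 ⟨a, ha⟩)
  exact ⟨m, by rw [HomLim.smul_mk_eq_of κ f ha, ← hm]; rfl⟩

theorem toLoc_eq_zero_iff (κ : KernelFunctor R) {m : Ω} :
    κ.toLoc Ω m = 0 ↔ m ∈ κ.tors Ω := by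
  constructor
  · intro h
    obtain ⟨K, hK, _, _, hKm⟩ := HomLim.mk_eq_mk.1 (h.trans HomLim.mk_zero.symm)
    rw [← Submodule.Quotient.mk_eq_zero (κ.tors Ω), ← Submodule.mem_bot R, ← κ.tors_quotient]
    exact κ.mem_tors_of_forall_smul_eq_zero hK hKm
  · intro h
    rw [toLoc, LinearMap.comp_apply, Submodule.mkQ_apply,
      (Submodule.Quotient.mk_eq_zero _).2 h, map_zero]

theorem toLoc_eq_toLoc_iff (κ : KernelFunctor R) {m m' : Ω} :
    κ.toLoc Ω m = κ.toLoc Ω m' ↔ m - m' ∈ κ.tors Ω := by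
  rw [← toLoc_eq_zero_iff, map_sub, sub_eq_zero]

theorem restrict_toLoc {κ τ : KernelFunctor R} (h : κ ≤ τ) (m : Ω) :
    restrict h Ω (κ.toLoc Ω m) = τ.toLoc Ω m :=
  HomLim.mk_eq_mk.2 ⟨⊤, τ.isDense_top, le_rfl, le_rfl, fun _ _ => rfl⟩

end Loc

end KernelFunctor

/-! ### The filtration of `Ω` -/

namespace Glider

variable {R : Type u} [Ring R] {F : RingFiltration R} {Ω : Type u} [AddCommGroup Ω] [Module R Ω]
  (M : Glider F Ω)

theorem smul_mem_filtration {i n : ℤ} {a : R} (ha : a ∈ F.deg i) {m : Ω}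
    (hm : m ∈ M.filtration n) : a • m ∈ M.filtration (i + n) := by
  suffices h : M.filtration n ≤
      (M.filtration (i + n)).comap (DistribSMul.toAddMonoidHom Ω a) from h hm
  refine iSup_le fun j => (AddSubgroup.closure_le _).2 ?_
  rintro _ ⟨r, hr, y, hy, rfl⟩
  refine (le_iSup (fun j : ℕ => AddSubgroup.closure
      {x | ∃ r ∈ F.deg (i + n + j), ∃ m ∈ M.part j, x = r • m}) j) ?_
  refine AddSubgroup.subset_closure ⟨a * r, ?_, y, hy, smul_smul a r y⟩
  rw [add_assoc]
  exact F.mul_mem ha hr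

theorem filtration_mono : Monotone M.filtration := fun _ _ h =>
  iSup_mono fun _ => AddSubgroup.closure_mono fun _ ⟨r, hr, y, hy, e⟩ =>
    ⟨r, F.mono (by lia) hr, y, hy, e⟩

theorem filtration_zero : M.filtration 0 = M.part 0 := by
  simpa using M.filtration_neg 0

/-- `FΩ` is exhaustive because `M` generates `Ω` and `FR` is exhaustive. -/
theorem exists_mem_filtration (m : Ω) : ∃ n, m ∈ M.filtration n := by
  have hm : m ∈ Submodule.span R (M.part 0 : Set Ω) := by rw [M.span_eq_top]; trivial
  induction hm using Submodule.span_induction with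
  | mem x hx => exact ⟨0, by rw [M.filtration_zero]; exact hx⟩
  | zero => exact ⟨0, zero_mem _⟩
  | add x y _ _ hx hy =>
    obtain ⟨n, hn⟩ := hx
    obtain ⟨k, hk⟩ := hy
    exact ⟨max n k, add_mem (M.filtration_mono (le_max_left _ _) hn)
      (M.filtration_mono (le_max_right _ _) hk)⟩
  | smul a x _ hx =>
    obtain ⟨n, hn⟩ := hx
    obtain ⟨i, hi⟩ := F.exhaustive a
    exact ⟨i + n, M.smul_mem_filtration hi hn⟩

/-- An element outside `F_n Ω` has a degree, which is larger than `n`. -/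
theorem exists_degree_of_notMem {n : ℤ} {m : Ω} (hm : m ∉ M.filtration n) :
    ∃ N, n < N ∧ m ∈ M.filtration N ∧ m ∉ M.filtration (N - 1) := by
  have hlt : ∀ N, m ∈ M.filtration N → n < N := fun N hN =>
    lt_of_not_ge fun h => hm (M.filtration_mono h hN)
  -- As `m ∉ F_n Ω`, every index whose step contains `m` exceeds `n`, so there is a least one.
  obtain ⟨N, hN, hmin⟩ := Int.exists_least_of_bdd (P := fun N => m ∈ M.filtration N)
    ⟨n, fun N hN => (hlt N hN).le⟩ (M.exists_mem_filtration m)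
  exact ⟨N, hlt N hN, hN, fun h => by linarith [hmin _ h]⟩

/-! ### Separatedness and the positive case -/

variable {M} {κ : KernelFunctor R}

theorem mem_filtration_or_mem_tors (hsep : (κ ⊓ κ).IsSeparated F M.filtration) {n : ℤ} {m : Ω}
    {I : Ideal R} (hI : I ∈ κ.filter)
    (h : ∀ γ, ∀ a ∈ I, a ∈ F.deg γ → a • m ∈ M.filtration (γ + n)) :
    m ∈ M.filtration n ∨ m ∈ κ.tors Ω := by
  refine or_iff_not_imp_left.2 fun hm => ?_
  obtain ⟨N, hnN, hN, hN'⟩ := M.exists_degree_of_notMem hm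
  exact κ.mem_tors_min_self.1 (hsep N m hN hN' ⟨I, κ.mem_filter_min_self hI, fun γ a ha haγ =>
    M.filtration_mono (by lia) (h γ a ha haγ)⟩)

/-- If `Ω` is `κ`-separated, then `κ(Ω) = Ω` or `κ(Ω) ⊆ M`. -/
theorem mem_filtration_zero_of_mem_tors (hsep : (κ ⊓ κ).IsSeparated F M.filtration)
    (hκ : κ.tors Ω ≠ ⊤) {t : Ω} (ht : t ∈ κ.tors Ω) : t ∈ M.filtration 0 := by
  by_contra ht0
  obtain ⟨N, hN0, hN, hN'⟩ := M.exists_degree_of_notMem ht0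
  obtain ⟨I, hI, hIt⟩ := κ.exists_forall_smul_eq_zero ht
  refine hκ (eq_top_iff.2 ?_)
  rw [← M.span_eq_top, Submodule.span_le]
  intro w hw
  replace hw : w ∈ M.filtration 0 := by rw [M.filtration_zero]; exact hw
  have hwN : ∀ k, 0 ≤ k → w ∈ M.filtration k := fun k hk => M.filtration_mono hk hw
  -- Adding `w` of degree at most `0` leaves the degree `N > 0` of `t` unchanged, while `I` sees
  -- only `w`; so `t + w` violates the degree bound and must be torsion, hence so is `w`.
  have hadd : t + w ∈ κ.tors Ω := by
    refine κ.mem_tors_min_self.1 (hsep N (t + w) (add_mem hN (hwN N hN0.le)) (fun h => hN' ?_)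
      ⟨I, κ.mem_filter_min_self hI, fun γ a ha haγ => ?_⟩)
    · simpa using sub_mem h (hwN (N - 1) (by lia))
    · rw [smul_add, hIt a ha, zero_add]
      exact M.filtration_mono (by lia) (M.smul_mem_filtration haγ hw)
  simpa using sub_mem hadd ht

/-- The torsion error lies in `F_0 Ω`, hence in `F_{γ+n} Ω` when `γ, n ≥ 0`; for `γ < 0` positivity
gives `a = 0`. -/
theorem smul_mem_filtration_of_isPositive (hF : F.IsPositive)
    (hsep : (κ ⊓ κ).IsSeparated F M.filtration) (hκ : κ.tors Ω ≠ ⊤) {n : ℤ} (hn : 0 ≤ n) {m : Ω}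
    {I : Ideal R} (h : ∀ γ, ∀ a ∈ I, a ∈ F.deg γ → ∃ u ∈ M.filtration (γ + n),
      a • m - u ∈ κ.tors Ω) :
    ∀ γ, ∀ a ∈ I, a ∈ F.deg γ → a • m ∈ M.filtration (γ + n) := by
  intro γ a ha haγ
  rcases lt_or_ge γ 0 with hγ | hγ
  · rw [hF γ hγ, AddSubgroup.mem_bot] at haγ
    rw [haγ, zero_smul]
    exact zero_mem _
  · obtain ⟨u, hu, htors⟩ := h γ a ha haγ
    have := M.filtration_mono (add_nonneg hγ hn) (mem_filtration_zero_of_mem_tors hsep hκ htors)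
    simpa using add_mem this hu

/-! ### The pseudo-affine case, through the Rees ring -/

variable (M) in
/-- The left ideal of the Rees ring of all `p` with `p_k m ∈ F_{k+n} Ω` for all `k`. -/
def reesConductor (n : ℤ) (m : Ω) : Ideal F.rees where
  carrier := {p | ∀ k, p.1.coeff k • m ∈ M.filtration (k + n)}
  zero_mem' := fun k => by simp
  add_mem' := fun {p q} hp hq k => by
    have := add_mem (hp k) (hq k)
    rwa [← add_smul] at this
  smul_mem' := fun p q hq k => by
    rw [smul_eq_mul, Subring.coe_mul, AddMonoidAlgebra.coeff_mul, Finsupp.sum, Finset.sum_smul]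
    refine sum_mem fun i _ => ?_
    rw [Finsupp.sum, Finset.sum_smul]
    refine sum_mem fun j _ => ?_
    split_ifs with h
    · rw [mul_smul, ← h, add_assoc]
      exact M.smul_mem_filtration (p.2 i) (hq j)
    · rw [zero_smul]
      exact zero_mem _

/-- Each homogeneous error is killed by its own ideal of the filter, with no uniform choice over
`I`. An element of `Ĩ` has only finitely many coefficients, so a finite intersection serves for it,
and the Gabriel property on the Rees ring turns these separate choices into a single `I'`. -/
theorem exists_smul_mem_filtration_of_isPseudoAffine (hκ : κ.IsPseudoAffine F) {n : ℤ} {m : Ω}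
    {I : Ideal R} (hI : I ∈ κ.filter) (h : ∀ γ, ∀ a ∈ I, a ∈ F.deg γ →
      ∃ u ∈ M.filtration (γ + n), a • m - u ∈ κ.tors Ω) :
    ∃ I' ∈ κ.filter, ∀ γ, ∀ a ∈ I', a ∈ F.deg γ → a • m ∈ M.filtration (γ + n) := by
  obtain ⟨κ', hκ'⟩ := hκ
  have hdense : M.reesConductor n m ∈ κ'.filter := by
    refine κ'.isDense_of_forall_colonRight ((hκ' _).2 ⟨I, hI, le_rfl⟩) fun p hp => ?_
    have hann : ∀ j, ∃ u ∈ M.filtration (j + n), ∃ K ∈ κ.filter, ∀ b ∈ K,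
        b • p.1.coeff j • m = b • u := fun j => by
      obtain ⟨u, hu, ht⟩ := h j _ (hp j) (p.2 j)
      obtain ⟨K, hK, hKt⟩ := κ.exists_forall_smul_eq_zero ht
      exact ⟨u, hu, K, hK, fun b hb => by rw [← sub_eq_zero, ← smul_sub, hKt b hb]⟩
    choose u hu K hK hKu using hann
    have hinf : ∀ s : Finset ℤ, s.inf K ∈ κ.filter := fun s =>
      Finset.inf_induction κ.isDense_top (fun _ h₁ _ h₂ => Order.PFilter.inf_mem h₁ h₂)
        (fun j _ => hK j)
    -- Multiplying `p` by elements with coefficients in every `K j` replaces each `p_j m` by `u j`,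
    -- which has the correct degree.
    refine (hκ' _).2 ⟨p.1.coeff.support.inf K, hinf _, fun q hq k => ?_⟩
    rw [LinearMap.toSpanSingleton_apply, smul_eq_mul, Subring.coe_mul, AddMonoidAlgebra.coeff_mul,
      Finsupp.sum, Finset.sum_smul]
    refine sum_mem fun i _ => ?_
    rw [Finsupp.sum, Finset.sum_smul]
    refine sum_mem fun j hj => ?_
    split_ifs with hij
    · rw [mul_smul, hKu j _ ((Finset.inf_le hj : _ ≤ K j) (hq i)), ← hij, add_assoc]
      exact M.smul_mem_filtration (q.2 i) (hu j)
    · rw [zero_smul]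
      exact zero_mem _
  obtain ⟨I', hI', hle⟩ := (hκ' _).1 hdense
  refine ⟨I', hI', fun γ a ha haγ => ?_⟩
  have hcoeff : ∀ k, (AddMonoidAlgebra.single γ a : LaurentPolynomial R).coeff k =
      if γ = k then a else 0 := fun k => by
    rw [AddMonoidAlgebra.coeff_single, Finsupp.single_apply]
  -- Homogeneous elements of `I'` are tested through the monomial `a X^γ`.
  let p : F.rees := ⟨AddMonoidAlgebra.single γ a, fun k => by
    rw [hcoeff]
    split_ifs with h
    · exact h ▸ haγ
    · exact zero_mem _⟩
  have hp : p ∈ F.reesIdeal I' := fun k => by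
    change (AddMonoidAlgebra.single γ a : LaurentPolynomial R).coeff k ∈ I'
    rw [hcoeff]
    split_ifs
    · exact ha
    · exact zero_mem _
  have := hle hp γ
  change (AddMonoidAlgebra.single γ a : LaurentPolynomial R).coeff γ • m ∈ _ at this
  rwa [hcoeff, if_pos rfl] at this

/-! ### The dichotomy and the theorem -/

/-- If `a ∈ F_n R` and `q ∈ F_0 Q_κ(Ω)` satisfy `a q = j_κ(m)`, then `m ∈ F_n Ω` or
`m ∈ κ(Ω)`. -/
theorem mem_filtration_or_mem_tors_of_smul_eq (hκ : F.IsPositive ∨ κ.IsPseudoAffine F)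
    (hsep : (κ ⊓ κ).IsSeparated F M.filtration) {q : κ.Loc Ω} (hq : q ∈ M.localization κ)
    {n : ℤ} {a : R} (ha : a ∈ F.deg n) {m : Ω} (hm : a • q = κ.toLoc Ω m) :
    m ∈ M.filtration n ∨ m ∈ κ.tors Ω := by
  obtain ⟨I, hI, hIq⟩ := hq
  have hI' : KernelFunctor.colonRight I a ∈ κ.filter := KernelFunctor.IsDense.colonRight hI a
  -- For `b ∈ (I : a)` the product `b a` lies in `I ∩ F_{γ+n} R`, so `b m` and `(b a) q` have the
  -- same image, which comes from `F_{γ+n} Ω`.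
  have key : ∀ γ, ∀ b ∈ KernelFunctor.colonRight I a, b ∈ F.deg γ →
      ∃ u ∈ M.filtration (γ + n), b • m - u ∈ κ.tors Ω := fun γ b hb hbγ => by
    obtain ⟨u, hu, hbu⟩ := hIq (γ + n) (b * a) hb (F.mul_mem hbγ ha)
    refine ⟨u, by simpa using hu, κ.toLoc_eq_toLoc_iff.1 ?_⟩
    rw [map_smul, ← hm, smul_smul, hbu]
  rcases hκ with hF | hκ
  · rcases lt_or_ge n 0 with hn | hn
    · rw [hF n hn, AddSubgroup.mem_bot] at ha
      rw [ha, zero_smul] at hm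
      exact Or.inr (κ.toLoc_eq_zero_iff.1 hm.symm)
    · by_cases htop : κ.tors Ω = ⊤
      · exact Or.inr (htop ▸ trivial)
      · exact mem_filtration_or_mem_tors hsep hI'
          (smul_mem_filtration_of_isPositive hF hsep htop hn key)
  · obtain ⟨I', hI', h⟩ := exists_smul_mem_filtration_of_isPseudoAffine hκ hI' key
    exact mem_filtration_or_mem_tors hsep hI' h

end Glider

theorem mainTheorem3 {R : Type u} [Ring R] (F : RingFiltration R)
    {Ω : Type u} [AddCommGroup Ω] [Module R Ω] (M : Glider F Ω)
    {ι : Type*} [Finite ι] (κ : ι → KernelFunctor R)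
    (hκ : F.IsPositive ∨ ∀ i, (κ i).IsPseudoAffine F)
    (hsep : ∀ i j, (κ i ⊓ κ j).IsSeparated F M.filtration)
    (s : ∀ i, (κ i).Loc Ω) (hs : ∀ i, s i ∈ M.localization (κ i))
    (hcompat : ∀ i j,
      KernelFunctor.restrict (KernelFunctor.le_join_left (κ i) (κ j)) Ω (s i) =
        KernelFunctor.restrict (KernelFunctor.le_join_right (κ i) (κ j)) Ω (s j))
    (x : (⨅ i, κ i).Loc Ω)
    (hx : ∀ i, KernelFunctor.restrict (KernelFunctor.meet_le κ i) Ω x = s i) :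
    x ∈ M.localization (⨅ i, κ i) := by
  obtain ⟨J, hJ, hJx⟩ := KernelFunctor.exists_smul_eq_toLoc _ x
  refine ⟨J, hJ, fun n a ha han => ?_⟩
  rw [add_zero]
  obtain ⟨m, hm⟩ := hJx a ha
  by_cases hmn : m ∈ M.filtration n
  · exact ⟨m, hmn, hm⟩
  -- Outside `F_n Ω`, only the torsion alternative is left for each `i`, so `a x` vanishes.
  refine ⟨0, zero_mem _, ?_⟩
  rw [hm, map_zero, KernelFunctor.toLoc_eq_zero_iff]
  refine (KernelFunctor.mem_tors_sInf _).2 ?_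
  rintro _ ⟨i, rfl⟩
  have hi : a • s i = (κ i).toLoc Ω m := by
    rw [← hx i, ← map_smul, hm, KernelFunctor.restrict_toLoc]
  exact (Glider.mem_filtration_or_mem_tors_of_smul_eq (hκ.imp_right fun h => h i) (hsep i i) (hs i)
    han hi).resolve_left hmn
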